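/- Theorem (asymptotic normality of the square root of a Wishart matrix). Fix an integer $p\ge 1$. For each integer $m\ge p$ let $W=W^{(m)}\sim W_p(m,I_p)$ be a standard Wishart matrix, i.e. $W$ has the distribution of $\sum_{i=1}^m X_iX_i^\top$ with $X_1,\dots,X_m$ independent $\mathcal N_p(0,I_p)$ random vectors, and let $V=(v_{ij})=W^{1/2}$ be its symmetric positive semidefinite square root (almost surely positive definite). Then, as $m\to\infty$, $$(v_{11}-\sqrt m,\dots,v_{pp}-\sqrt m,\,v_{12},\dots,v_{p-1,p})^\top \xrightarrow{d} \mathcal N_{p(p+1)/2}\left(0,\begin{pmatrix}\tfrac12 I_p&0\\0&\tfrac14 I_{p(p-1)/2}\end{pmatrix}\right),$$ where the vector lists the diagonal entries of $V-\sqrt m\,I_p$ followed by its entries strictly above the diagonal, and convergence in distribution means weak convergence of the laws, and also convergence of the joint distribution functions at every continuity point of the limiting one. Equivalently, in matrix form, $$W^{1/2}-\sqrt m\,I_p\xrightarrow{d}\tfrac12 G,$$ where $G$ is a $p\times p$ Gaussian Wigner matrix: a random symmetric matrix whose diagonal entries are $\mathcal N(0,2)$, whose entries strictly above the diagonal are $\mathcal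 N(0,1)$, and all of these entries are mutually independent. -/

import Mathlib

open MeasureTheory ProbabilityTheory Filter
open scoped Topology MatrixOrder

/-- Matrices carry the product σ-algebra of their entries. -/
instance Matrix.instMeasurableSpaceEntries {m n α : Type*} [MeasurableSpace α] :
    MeasurableSpace (Matrix m n α) :=
  inferInstanceAs (MeasurableSpace (m → n → α))

instance Matrix.instBorelSpaceReal {m n : Type*} [Countable m] [Countable n] :
    BorelSpace (Matrix m n ℝ) :=
  inferInstanceAs (BorelSpace (m → n → ℝ))

/-- The Wishart distribution `W_p(m, S)`: the law of `∑ᵢ Xᵢ Xᵢᵀ` where `X₁, …, X_m` are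
independent with common law `N_p(0, S)` (`S` positive semidefinite). -/
noncomputable def wishartMeasure (p m : ℕ) (S : Matrix (Fin p) (Fin p) ℝ) :
    Measure (Matrix (Fin p) (Fin p) ℝ) :=
  (Measure.pi fun _ : Fin m => multivariateGaussian (0 : EuclideanSpace ℝ (Fin p)) S).map
    fun X => ∑ i, Matrix.vecMulVec (X i) (X i)

/-- Positions strictly above the diagonal of a `p × p` matrix. -/
abbrev StrictUpper (p : ℕ) : Type := {ij : Fin p × Fin p // ij.1 < ij.2}

/-- The vector of the diagonal entries of a matrix followed by its entries strictly above the
diagonal. -/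
noncomputable def upperVec {p : ℕ} (A : Matrix (Fin p) (Fin p) ℝ) :
    EuclideanSpace ℝ (Fin p ⊕ StrictUpper p) :=
  WithLp.toLp 2 (Sum.elim (fun i => A i i) (fun ij => A ij.1.1 ij.1.2))

/-- The block matrix `diag(½ I_p, ¼ I_{p(p-1)/2})`. -/
noncomputable def limitCov (p : ℕ) :
    Matrix (Fin p ⊕ StrictUpper p) (Fin p ⊕ StrictUpper p) ℝ :=
  Matrix.fromBlocks ((1 / 2 : ℝ) • 1) 0 0 ((1 / 4 : ℝ) • 1)

/-- The random matrix `G` is a Gaussian Wigner matrix: symmetric, with diagonal entries `N(0, 2)`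
and entries above the diagonal `N(0, 1)`, all of these being mutually independent. -/
structure IsGaussianWigner {p : ℕ} {Ω : Type*} [MeasurableSpace Ω]
    (G : Ω → Matrix (Fin p) (Fin p) ℝ) (P : Measure Ω) : Prop where
  symm : ∀ᵐ ω ∂P, (G ω).IsSymm
  diag : ∀ i, HasLaw (fun ω => G ω i i) (gaussianReal 0 2) P
  upper : ∀ i j, i < j → HasLaw (fun ω => G ω i j) (gaussianReal 0 1) P
  indep : iIndepFun (fun k ω => upperVec (G ω) k) P

/-- The joint distribution function `x ↦ P(X ≤ x)` (coordinatewise order) of a random vector. -/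
noncomputable def distFun {ι Ω : Type*} [MeasurableSpace Ω] (P : Measure Ω)
    (X : Ω → EuclideanSpace ℝ ι) (x : EuclideanSpace ℝ ι) : ℝ :=
  P.real {ω | ∀ i, X ω i ≤ x i}

open scoped RealInnerProductSpace

/-! ### Moments of the standard Gaussian distribution -/

/-! Put `c = √m`, `V = W^{1/2}` and `D = V - c I`. Since `W = V²`, one has exactly `½ (W/c - c I) =
D + D²/(2c)`, so `D` is half the normalized Wishart matrix up to a quadratic remainder.

The main term is a normalized sum of iid centered matrices `X Xᵀ - I`. Gaussian moments up to order
four give its entries variance 2 on the diagonal, 1 above it, and no correlation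
(`covariance_upperVec_vecMulVec`). The one-dimensional central limit theorem for every linear
functional, with Lévy's continuity theorem, yields the Gaussian limit, and the factor ½ turns 2 and
1 into ½ and ¼ (`tendstoInDistribution_half_smul_scatterDeviation`).

For the remainder, positivity of `V` gives the global Frobenius bound `‖D‖ ≤ ‖W/c - c I‖`
(`Matrix.sum_sq_cfcSqrt_sub_le`). The right side has bounded second moment
(`integral_norm_scatterDeviation_sq`), so `D²/(2c)` is `O(1/√m)` in `L¹`, and Slutsky's theorem
concludes. -/

lemma integral_pow_gaussianReal_zero_one_eq_iteratedDeriv (n : ℕ) :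
    ∫ x, x ^ n ∂gaussianReal 0 1 = iteratedDeriv n (fun t : ℝ => Real.exp (t ^ 2 / 2)) 0 := by
  have h := iteratedDeriv_mgf_zero (X := fun x : ℝ => x) (μ := gaussianReal 0 1) (by simp) n
  rw [mgf_fun_id_gaussianReal] at h
  simpa using h.symm

lemma deriv_mul_exp_sq_div_two {f : ℝ → ℝ} {f' : ℝ → ℝ} (hf : ∀ t, HasDerivAt f (f' t) t) :
    deriv (fun t => f t * Real.exp (t ^ 2 / 2)) =
      fun t => (f' t + t * f t) * Real.exp (t ^ 2 / 2) := by
  ext t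
  have h1 : HasDerivAt (fun t : ℝ => t ^ 2 / 2) t t := by
    simpa using (hasDerivAt_pow 2 t).div_const 2
  rw [((hf t).fun_mul h1.exp).deriv]
  ring

/-- Each derivative acts on the polynomial factor by `f ↦ f' + t f`; the constant terms 0, 1, 0, 3
are the moments. -/
lemma iteratedDeriv_exp_sq_div_two :
    iteratedDeriv 1 (fun t : ℝ => Real.exp (t ^ 2 / 2)) = (fun t => t * Real.exp (t ^ 2 / 2)) ∧
    iteratedDeriv 2 (fun t : ℝ => Real.exp (t ^ 2 / 2)) =
      (fun t => (1 + t ^ 2) * Real.exp (t ^ 2 / 2)) ∧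
    iteratedDeriv 3 (fun t : ℝ => Real.exp (t ^ 2 / 2)) =
      (fun t => (3 * t + t ^ 3) * Real.exp (t ^ 2 / 2)) ∧
    iteratedDeriv 4 (fun t : ℝ => Real.exp (t ^ 2 / 2)) =
      (fun t => (3 + 6 * t ^ 2 + t ^ 4) * Real.exp (t ^ 2 / 2)) := by
  have h1 : iteratedDeriv 1 (fun t : ℝ => Real.exp (t ^ 2 / 2)) =
      (fun t => t * Real.exp (t ^ 2 / 2)) := by
    rw [iteratedDeriv_one]
    have := deriv_mul_exp_sq_div_two (fun t => hasDerivAt_const t (1 : ℝ))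
    simpa using this
  have h2 : iteratedDeriv 2 (fun t : ℝ => Real.exp (t ^ 2 / 2)) =
      (fun t => (1 + t ^ 2) * Real.exp (t ^ 2 / 2)) := by
    rw [iteratedDeriv_succ, h1, deriv_mul_exp_sq_div_two (fun t => hasDerivAt_id' t)]
    ext t; ring
  have h3 : iteratedDeriv 3 (fun t : ℝ => Real.exp (t ^ 2 / 2)) =
      (fun t => (3 * t + t ^ 3) * Real.exp (t ^ 2 / 2)) := by
    rw [iteratedDeriv_succ, h2,
      deriv_mul_exp_sq_div_two (fun t => (hasDerivAt_pow 2 t).const_add (1 : ℝ))]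
    ext t; norm_num; ring
  refine ⟨h1, h2, h3, ?_⟩
  rw [iteratedDeriv_succ, h3, deriv_mul_exp_sq_div_two
    (fun t => ((hasDerivAt_id' t).const_mul (3 : ℝ)).fun_add (hasDerivAt_pow 3 t))]
  ext t; norm_num; ring

lemma integral_pow_two_gaussianReal : ∫ x, x ^ 2 ∂gaussianReal 0 1 = 1 := by
  rw [integral_pow_gaussianReal_zero_one_eq_iteratedDeriv, iteratedDeriv_exp_sq_div_two.2.1]; simp

lemma integral_pow_three_gaussianReal : ∫ x, x ^ 3 ∂gaussianReal 0 1 = 0 := by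
  rw [integral_pow_gaussianReal_zero_one_eq_iteratedDeriv, iteratedDeriv_exp_sq_div_two.2.2.1]
  simp

lemma integral_pow_four_gaussianReal : ∫ x, x ^ 4 ∂gaussianReal 0 1 = 3 := by
  rw [integral_pow_gaussianReal_zero_one_eq_iteratedDeriv, iteratedDeriv_exp_sq_div_two.2.2.2]
  simp

lemma integrable_pow_gaussianReal (n : ℕ) : Integrable (fun x : ℝ => x ^ n) (gaussianReal 0 1) := by
  rcases eq_or_ne n 0 with rfl | hn
  · simp
  have h := memLp_id_gaussianReal (μ := 0) (v := 1) (n : NNReal)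
  refine (integrable_norm_iff (by fun_prop)).1 ?_
  simpa using h.integrable_norm_pow hn

section Monomial

variable {ι : Type*} [Fintype ι]

lemma stdGaussian_map_ofLp :
    (stdGaussian (EuclideanSpace ℝ ι)).map WithLp.ofLp =
      Measure.pi fun _ : ι => gaussianReal 0 1 := by
  rw [← map_pi_eq_stdGaussian, Measure.map_map (by fun_prop) (by fun_prop)]
  exact Measure.map_id

lemma integral_monomial_stdGaussian (n : ι → ℕ) :
    ∫ x, ∏ s, x s ^ n s ∂stdGaussian (EuclideanSpace ℝ ι) =
      ∏ s, ∫ x, x ^ n s ∂gaussianReal 0 1 := by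
  rw [← integral_fintype_prod_eq_prod (fun s (x : ℝ) => x ^ n s), ← stdGaussian_map_ofLp,
    integral_map (by fun_prop)
      (continuous_finsetProd _ fun s _ => by fun_prop).aestronglyMeasurable]

lemma integrable_monomial_stdGaussian (n : ι → ℕ) :
    Integrable (fun x : EuclideanSpace ℝ ι => ∏ s, x s ^ n s)
      (stdGaussian (EuclideanSpace ℝ ι)) := by
  have h := Integrable.fintype_prod (f := fun (s : ι) (x : ℝ) => x ^ n s)
    (μ := fun _ : ι => gaussianReal 0 1) (fun s => integrable_pow_gaussianReal (n s))
  rw [← stdGaussian_map_ofLp] at h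
  exact h.comp_measurable (by fun_prop)

lemma memLp_two_monomial_stdGaussian (n : ι → ℕ) :
    MemLp (fun x : EuclideanSpace ℝ ι => ∏ s, x s ^ n s) 2
      (stdGaussian (EuclideanSpace ℝ ι)) := by
  rw [memLp_two_iff_integrable_sq (by fun_prop)]
  refine (integrable_monomial_stdGaussian (fun s => n s * 2)).congr (ae_of_all _ fun x => ?_)
  simp [pow_mul, Finset.prod_pow]

end Monomial

/-! ### Quadratic monomials -/

/-- The exponents of the monomial `x ↦ (x xᵀ)ₖ`, where `k` is a position on or above the
diagonal. -/
def upperExponent {p : ℕ} : Fin p ⊕ StrictUpper p → Fin p → ℕ :=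
  Sum.elim (fun i => Pi.single i 2) (fun ij => Pi.single ij.1.1 1 + Pi.single ij.1.2 1)

lemma prod_pow_single {ι : Type*} [Fintype ι] [DecidableEq ι] (x : ι → ℝ) (i : ι) (n : ℕ) :
    ∏ s, x s ^ (Pi.single i n : ι → ℕ) s = x i ^ n := by
  rw [Finset.prod_eq_single i]
  · simp
  · intro j _ hj; simp [Pi.single_eq_of_ne hj]
  · simp

lemma upperVec_vecMulVec {p : ℕ} (x : EuclideanSpace ℝ (Fin p)) (k : Fin p ⊕ StrictUpper p) :
    upperVec (Matrix.vecMulVec x x) k = ∏ s, x s ^ upperExponent k s := by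
  rcases k with i | ij
  · simp [upperVec, upperExponent, prod_pow_single, Matrix.vecMulVec_apply, sq]
  · simp [upperVec, upperExponent, pow_add, Finset.prod_mul_distrib, prod_pow_single,
      Matrix.vecMulVec_apply]

lemma memLp_upperVec_vecMulVec {p : ℕ} (k : Fin p ⊕ StrictUpper p) :
    MemLp (fun x : EuclideanSpace ℝ (Fin p) => upperVec (Matrix.vecMulVec x x) k) 2
      (stdGaussian (EuclideanSpace ℝ (Fin p))) := by
  simp_rw [upperVec_vecMulVec]
  exact memLp_two_monomial_stdGaussian _

lemma integral_upperVec_vecMulVec {p : ℕ} (k : Fin p ⊕ StrictUpper p) :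
    ∫ x : EuclideanSpace ℝ (Fin p), upperVec (Matrix.vecMulVec x x) k
      ∂stdGaussian (EuclideanSpace ℝ (Fin p)) = upperVec (1 : Matrix (Fin p) (Fin p) ℝ) k := by
  simp_rw [upperVec_vecMulVec]
  rw [integral_monomial_stdGaussian]
  rcases k with i | ⟨⟨i, j⟩, hij⟩
  · rw [Finset.prod_eq_single i]
    · simp [upperExponent, upperVec, integral_pow_two_gaussianReal]
    · intro j _ hj; simp [upperExponent, Pi.single_eq_of_ne hj]
    · simp
  · simp only at hij
    rw [Finset.prod_eq_zero (Finset.mem_univ i)]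
    · simp [upperVec, Matrix.one_apply_ne hij.ne]
    · simp [upperExponent, Pi.single_eq_of_ne hij.ne, integral_id_gaussianReal]

/-- The mixed moment factors over coordinates. Diagonal entries have variance `3 - 1 = 2`, those
above have variance 1. Two distinct diagonal entries give `1 - 1 = 0`; in the other cases some
coordinate occurs to an odd power. -/
lemma covariance_upperVec_vecMulVec {p : ℕ} (k l : Fin p ⊕ StrictUpper p) :
    cov[fun x : EuclideanSpace ℝ (Fin p) => upperVec (Matrix.vecMulVec x x) k,
      fun x : EuclideanSpace ℝ (Fin p) => upperVec (Matrix.vecMulVec x x) l;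
      stdGaussian (EuclideanSpace ℝ (Fin p))] = 4 * limitCov p k l := by
  rw [covariance_eq_sub (memLp_upperVec_vecMulVec k) (memLp_upperVec_vecMulVec l),
    integral_upperVec_vecMulVec, integral_upperVec_vecMulVec]
  simp only [Pi.mul_apply, upperVec_vecMulVec, ← Finset.prod_mul_distrib, ← pow_add]
  rw [integral_monomial_stdGaussian (fun s => upperExponent k s + upperExponent l s)]
  have m1 : ∫ x : ℝ, x ∂gaussianReal 0 1 = 0 := integral_id_gaussianReal
  have m2 := integral_pow_two_gaussianReal
  have m3 := integral_pow_three_gaussianReal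
  have m4 := integral_pow_four_gaussianReal
  rcases k with i | ⟨⟨i, j⟩, hij⟩ <;> rcases l with a | ⟨⟨a, b⟩, hab⟩
  · rcases eq_or_ne i a with rfl | h
    · rw [Finset.prod_eq_single i]
      · simp [upperExponent, upperVec, limitCov, m4]; norm_num
      · intro j _ hj; simp [upperExponent, Pi.single_eq_of_ne hj]
      · simp
    · rw [Finset.prod_eq_one]
      · simp [upperVec, limitCov, Matrix.one_apply_ne h]
      · intro s _
        rcases eq_or_ne s i with rfl | h1
        · simp [upperExponent, Pi.single_eq_of_ne h, m2]
        rcases eq_or_ne s a with rfl | h2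
        · simp [upperExponent, Pi.single_eq_of_ne h1, m2]
        simp [upperExponent, Pi.single_eq_of_ne h1, Pi.single_eq_of_ne h2]
  · simp only at hab
    rw [Finset.prod_eq_zero (Finset.mem_univ a)]
    · simp [upperVec, limitCov, Matrix.one_apply_ne hab.ne]
    · rcases eq_or_ne a i with rfl | h1
      · simp [upperExponent, Pi.single_eq_of_ne hab.ne, m3]
      · simp [upperExponent, Pi.single_eq_of_ne hab.ne, Pi.single_eq_of_ne h1, m1]
  · simp only at hij
    rw [Finset.prod_eq_zero (Finset.mem_univ i)]
    · simp [upperVec, limitCov, Matrix.one_apply_ne hij.ne]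
    · rcases eq_or_ne i a with rfl | h1
      · simp [upperExponent, Pi.single_eq_of_ne hij.ne, m3]
      · simp [upperExponent, Pi.single_eq_of_ne hij.ne, Pi.single_eq_of_ne h1, m1]
  · simp only at hij hab
    by_cases h : i = a ∧ j = b
    · obtain ⟨rfl, rfl⟩ := h
      rw [Finset.prod_eq_one]
      · simp [upperVec, limitCov, Matrix.one_apply_ne hij.ne]
      · intro s _
        rcases eq_or_ne s i with rfl | h1
        · simp [upperExponent, Pi.single_eq_of_ne hij.ne, m2]
        rcases eq_or_ne s j with rfl | h2
        · simp [upperExponent, Pi.single_eq_of_ne h1, m2]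
        simp [upperExponent, Pi.single_eq_of_ne h1, Pi.single_eq_of_ne h2]
    · have hne : (⟨(i, j), hij⟩ : StrictUpper p) ≠ ⟨(a, b), hab⟩ := by
        simpa [Subtype.ext_iff, Prod.ext_iff] using h
      have hr : upperVec (1 : Matrix (Fin p) (Fin p) ℝ) (Sum.inr ⟨(i, j), hij⟩) = 0 := by
        simp [upperVec, Matrix.one_apply_ne hij.ne]
      rw [hr]
      simp only [limitCov, Matrix.fromBlocks_apply₂₂, Matrix.smul_apply, Matrix.one_apply_ne hne,
        smul_zero, mul_zero, zero_mul, sub_zero]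
      -- Two distinct pairs differ in some index, which then has total exponent 1. The ordering
      -- within pairs makes the chosen witness occur only once: for `i = b`, `a < b = i < j`.
      have key : ∃ s, upperExponent (Sum.inr ⟨(i, j), hij⟩) s
          + upperExponent (Sum.inr ⟨(a, b), hab⟩) s = 1 := by
        by_cases h1 : i = a
        · refine ⟨j, ?_⟩
          have : j ≠ b := fun h2 => h ⟨h1, h2⟩
          subst h1
          simp [upperExponent, Pi.single_eq_of_ne hij.ne', Pi.single_eq_of_ne this]
        · by_cases h2 : i = b
          · refine ⟨a, ?_⟩
            subst h2
            simp [upperExponent, Pi.single_eq_of_ne hab.ne, Pi.single_eq_of_ne (hab.trans hij).ne]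
          · refine ⟨i, ?_⟩
            simp [upperExponent, Pi.single_eq_of_ne hij.ne, Pi.single_eq_of_ne h1,
              Pi.single_eq_of_ne h2]
      obtain ⟨s, hs⟩ := key
      refine Finset.prod_eq_zero (Finset.mem_univ s) ?_
      simp [hs, m1]

/-! ### The square root of a positive semidefinite matrix -/

section Sqrt

variable {n : Type*} [Fintype n]

lemma Matrix.isClosed_setOf_nonneg : IsClosed {A : Matrix n n ℝ | 0 ≤ A} := by
  have : {A : Matrix n n ℝ | 0 ≤ A} =
      {A | A.conjTranspose = A} ∩ ⋂ x : n → ℝ, {A | 0 ≤ star x ⬝ᵥ A.mulVec x} := by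
    ext A
    simp [Matrix.nonneg_iff_posSemidef, Matrix.posSemidef_iff_dotProduct_mulVec,
      Matrix.IsHermitian]
  rw [this]
  refine (isClosed_eq (by fun_prop) (by fun_prop)).inter (isClosed_iInter fun x => ?_)
  exact isClosed_le (by fun_prop) (by fun_prop)

/-- On the closed cone of positive semidefinite matrices the root inverts squaring, which is
continuous and injective there; by the Lusin–Souslin theorem such a map sends Borel sets to Borel
sets. Off the cone `CFC.sqrt` takes the default value 0, which accounts for the second piece of the
preimage. -/
lemma Matrix.measurable_cfcSqrt [DecidableEq n] :
    Measurable (CFC.sqrt : Matrix n n ℝ → Matrix n n ℝ) := by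
  intro T hT
  have : PolishSpace (Matrix n n ℝ) := inferInstanceAs (PolishSpace (n → n → ℝ))
  set s : Set (Matrix n n ℝ) := {A | 0 ≤ A}
  have hs : MeasurableSet s := Matrix.isClosed_setOf_nonneg.measurableSet
  have hcont : Continuous fun A : Matrix n n ℝ => A * A := by fun_prop
  have h1 : MeasurableSet ((fun A => A * A) '' (T ∩ s)) := by
    refine (hT.inter hs).image_of_continuousOn_injOn hcont.continuousOn ?_
    intro A hA B hB h
    rw [← CFC.sqrt_mul_self A hA.2, ← CFC.sqrt_mul_self B hB.2]
    exact congrArg CFC.sqrt h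
  have h2 : CFC.sqrt ⁻¹' T = (fun A => A * A) '' (T ∩ s) ∪
      (sᶜ ∩ {_A | (0 : Matrix n n ℝ) ∈ T}) := by
    ext A
    by_cases hA : 0 ≤ A
    · simp only [Set.mem_preimage, Set.mem_union, Set.mem_image, Set.mem_inter_iff,
        Set.mem_compl_iff, s, Set.mem_ofPred_eq, hA, not_true_eq_false, false_and, or_false]
      constructor
      · exact fun h => ⟨CFC.sqrt A, ⟨h, CFC.sqrt_nonneg A⟩, CFC.sqrt_mul_sqrt_self A hA⟩
      · rintro ⟨B, ⟨hB, hB0⟩, rfl⟩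
        rwa [CFC.sqrt_mul_self B hB0]
    · simp only [Set.mem_preimage, CFC.sqrt_of_not_nonneg hA, Set.mem_union, Set.mem_image,
        Set.mem_inter_iff, Set.mem_compl_iff, s, Set.mem_ofPred_eq, hA, not_false_eq_true,
        true_and, iff_or_self]
      rintro ⟨B, ⟨-, hB0⟩, rfl⟩
      refine absurd ?_ hA
      have := (Matrix.posSemidef_conjTranspose_mul_self B).nonneg
      rwa [(Matrix.nonneg_iff_posSemidef.1 hB0).isHermitian.eq] at this
  rw [h2]
  exact h1.union (hs.compl.inter (MeasurableSet.const _))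

lemma Matrix.isSymm_cfcSqrt [DecidableEq n] (A : Matrix n n ℝ) : (CFC.sqrt A).IsSymm := by
  have h := (Matrix.nonneg_iff_posSemidef.1 (CFC.sqrt_nonneg A)).isHermitian
  rwa [Matrix.IsHermitian, Matrix.conjTranspose_eq_transpose_of_trivial] at h

/-- In the expanded square of the Frobenius norm, the cross term is `2c tr(D V Dᵀ) ≥ 0`. -/
lemma Matrix.sq_mul_sum_sq_le_of_posSemidef {V : Matrix n n ℝ} (hV : V.PosSemidef)
    (D : Matrix n n ℝ) {c : ℝ} (hc : 0 ≤ c) :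
    c ^ 2 * ∑ i, ∑ j, D i j ^ 2 ≤ ∑ i, ∑ j, (D * V + c • D) i j ^ 2 := by
  have h1 : 0 ≤ ∑ i, ∑ j, (D * V) i j * D i j := by
    have h := (hV.mul_mul_conjTranspose_same D).trace_nonneg
    simpa [Matrix.trace, Matrix.mul_apply (M := D * V)] using h
  have h2 : ∑ i, ∑ j, (D * V + c • D) i j ^ 2 = ∑ i, ∑ j, (D * V) i j ^ 2 +
      2 * c * ∑ i, ∑ j, (D * V) i j * D i j + c ^ 2 * ∑ i, ∑ j, D i j ^ 2 := by
    simp only [Finset.mul_sum, ← Finset.sum_add_distrib, Matrix.add_apply, Matrix.smul_apply,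
      smul_eq_mul]
    refine Finset.sum_congr rfl fun i _ => Finset.sum_congr rfl fun j _ => ?_
    ring
  have h3 : 0 ≤ ∑ i, ∑ j, (D * V) i j ^ 2 := by positivity
  have h4 : 0 ≤ 2 * c * ∑ i, ∑ j, (D * V) i j * D i j := by positivity
  linarith

/-- The error of the linearization of the matrix square root at `c² • 1`. -/
lemma Matrix.cfcSqrt_sub_sub_half_smul [DecidableEq n] {S : Matrix n n ℝ} (hS : 0 ≤ S) {c : ℝ} (hc : 0 < c) :
    (CFC.sqrt S - c • 1) - (1 / 2 : ℝ) • (c⁻¹ • S - c • 1) =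
      -(2 * c)⁻¹ • ((CFC.sqrt S - c • 1) * (CFC.sqrt S - c • 1)) := by
  set V := CFC.sqrt S with hVdef
  have hVV : S = V * V := (CFC.sqrt_mul_sqrt_self S hS).symm
  rw [hVV]
  simp only [sub_mul, mul_sub, smul_mul_assoc, mul_smul_comm, one_mul, mul_one]
  ext i j
  simp only [Matrix.sub_apply, Matrix.smul_apply, smul_eq_mul]
  field_simp
  ring

/-- With `V = √S` and `D = V - c`, `D V + c D = V² - c² = c (S/c - c)`; the previous bound applies.
No closeness of `S` to `c²` is required. -/
lemma Matrix.sum_sq_cfcSqrt_sub_le [DecidableEq n] {S : Matrix n n ℝ} (hS : 0 ≤ S) {c : ℝ} (hc : 0 < c) :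
    ∑ i, ∑ j, (CFC.sqrt S - c • 1) i j ^ 2 ≤ ∑ i, ∑ j, (c⁻¹ • S - c • 1) i j ^ 2 := by
  have h := Matrix.sq_mul_sum_sq_le_of_posSemidef
    (Matrix.nonneg_iff_posSemidef.1 (CFC.sqrt_nonneg S)) (CFC.sqrt S - c • 1) hc.le
  have h1 : (CFC.sqrt S - c • 1) * CFC.sqrt S + c • (CFC.sqrt S - c • 1) =
      c • (c⁻¹ • S - c • 1) := by
    rw [sub_mul, CFC.sqrt_mul_sqrt_self S hS, smul_sub, smul_sub, smul_inv_smul₀ hc.ne']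
    simp
  rw [h1] at h
  simp only [Matrix.smul_apply (c), smul_eq_mul, mul_pow, ← Finset.mul_sum] at h
  exact le_of_mul_le_mul_left h (by positivity)

lemma Matrix.abs_mul_self_apply_le (D : Matrix n n ℝ) (i j : n) :
    |(D * D) i j| ≤ ∑ a, ∑ b, D a b ^ 2 := by
  have h1 : ∑ k, D i k ^ 2 ≤ ∑ a, ∑ b, D a b ^ 2 :=
    Finset.single_le_sum (f := fun a => ∑ b, D a b ^ 2) (fun a _ => by positivity)
      (Finset.mem_univ i)
  have h2 : ∑ k, D k j ^ 2 ≤ ∑ a, ∑ b, D a b ^ 2 :=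
    Finset.sum_le_sum fun a _ => Finset.single_le_sum (f := fun b => D a b ^ 2)
      (fun b _ => by positivity) (Finset.mem_univ j)
  -- The arithmetic-geometric mean inequality leaves half a row sum plus half a column sum of
  -- squares, each at most the full sum.
  have h3 : |(D * D) i j| ≤ ∑ k, (D i k ^ 2 + D k j ^ 2) / 2 := by
    rw [Matrix.mul_apply]
    refine (Finset.abs_sum_le_sum_abs _ _).trans (Finset.sum_le_sum fun k _ => ?_)
    rw [abs_le]
    constructor <;> nlinarith [sq_nonneg (D i k + D k j), sq_nonneg (D i k - D k j)]
  rw [← Finset.sum_div, Finset.sum_add_distrib] at h3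
  linarith

lemma Matrix.abs_cfcSqrt_sub_sub_half_smul_le [DecidableEq n] {S : Matrix n n ℝ} (hS : 0 ≤ S) {c : ℝ}
    (hc : 0 < c) (i j : n) :
    |((CFC.sqrt S - c • 1) - (1 / 2 : ℝ) • (c⁻¹ • S - c • 1)) i j| ≤
      (2 * c)⁻¹ * ∑ a, ∑ b, (c⁻¹ • S - c • 1) a b ^ 2 := by
  rw [Matrix.cfcSqrt_sub_sub_half_smul hS hc, Matrix.smul_apply, smul_eq_mul, abs_mul, abs_neg,
    abs_of_pos (by positivity)]
  gcongr
  exact (Matrix.abs_mul_self_apply_le _ i j).trans (Matrix.sum_sq_cfcSqrt_sub_le hS hc)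

end Sqrt

/-! ### Passing between symmetric matrices and vectors -/

lemma upperVec_sub {p : ℕ} (A B : Matrix (Fin p) (Fin p) ℝ) :
    upperVec (A - B) = upperVec A - upperVec B := by
  ext (i | i) <;> simp [upperVec]

lemma upperVec_smul {p : ℕ} (c : ℝ) (A : Matrix (Fin p) (Fin p) ℝ) :
    upperVec (c • A) = c • upperVec A := by
  ext (i | i) <;> simp [upperVec]

lemma upperVec_sum {p : ℕ} {ι : Type*} (s : Finset ι) (A : ι → Matrix (Fin p) (Fin p) ℝ) :
    upperVec (∑ k ∈ s, A k) = ∑ k ∈ s, upperVec (A k) := by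
  ext (i | i) <;> simp [upperVec, Matrix.sum_apply]

lemma continuous_upperVec {p : ℕ} :
    Continuous (upperVec : Matrix (Fin p) (Fin p) ℝ → _) := by
  refine (PiLp.continuous_toLp 2 _).comp (continuous_pi ?_)
  rintro (i | i) <;> simp only [Sum.elim_inl, Sum.elim_inr] <;> fun_prop

/-- The symmetric matrix with prescribed entries on and above the diagonal. -/
noncomputable def symmOfUpper {p : ℕ} (v : EuclideanSpace ℝ (Fin p ⊕ StrictUpper p)) :
    Matrix (Fin p) (Fin p) ℝ :=
  Matrix.of fun i j => if h : i < j then v (Sum.inr ⟨(i, j), h⟩)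
    else if h : j < i then v (Sum.inr ⟨(j, i), h⟩) else v (Sum.inl i)

lemma continuous_symmOfUpper {p : ℕ} : Continuous (symmOfUpper (p := p)) := by
  refine continuous_matrix fun i j => ?_
  simp only [symmOfUpper, Matrix.of_apply]
  split_ifs <;> fun_prop

/-- This continuous left inverse carries convergence of vectors back to symmetric matrices. -/
lemma symmOfUpper_upperVec {p : ℕ} {A : Matrix (Fin p) (Fin p) ℝ} (hA : A.IsSymm) :
    symmOfUpper (upperVec A) = A := by
  ext i j
  simp only [symmOfUpper, Matrix.of_apply]
  split_ifs with h1 h2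
  · simp [upperVec]
  · simp [upperVec, hA.apply]
  · obtain rfl : i = j := le_antisymm (not_lt.1 h2) (not_lt.1 h1)
    simp [upperVec]

lemma sum_sq_le_norm_upperVec_sq {p : ℕ} {A : Matrix (Fin p) (Fin p) ℝ} (hA : A.IsSymm) :
    ∑ i, ∑ j, A i j ^ 2 ≤ p ^ 2 * ‖upperVec A‖ ^ 2 := by
  have h : ∀ i j, A i j ^ 2 ≤ ‖upperVec A‖ ^ 2 := by
    intro i j
    have key : ∃ k, A i j = upperVec A k := by
      rcases lt_trichotomy i j with h | rfl | h
      · exact ⟨Sum.inr ⟨(i, j), h⟩, by simp [upperVec]⟩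
      · exact ⟨Sum.inl i, by simp [upperVec]⟩
      · exact ⟨Sum.inr ⟨(j, i), h⟩, by simp [upperVec, hA.apply]⟩
    obtain ⟨k, hk⟩ := key
    rw [hk, ← sq_abs, ← Real.norm_eq_abs]
    exact pow_le_pow_left₀ (norm_nonneg _) (PiLp.norm_apply_le _ k) 2
  calc ∑ i, ∑ j, A i j ^ 2 ≤ ∑ _i : Fin p, ∑ _j : Fin p, ‖upperVec A‖ ^ 2 :=
        Finset.sum_le_sum fun i _ => Finset.sum_le_sum fun j _ => h i j
    _ = p ^ 2 * ‖upperVec A‖ ^ 2 := by simp; ring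

/-! ### The limiting covariance -/

lemma limitCov_eq_diagonal (p : ℕ) :
    limitCov p = Matrix.diagonal (Sum.elim (fun _ => 1 / 2) (fun _ => 1 / 4)) := by
  ext (i | i) (j | j) <;> simp [limitCov, Matrix.diagonal_apply, Matrix.one_apply]

lemma posSemidef_limitCov (p : ℕ) : (limitCov p).PosSemidef := by
  rw [limitCov_eq_diagonal]
  refine Matrix.PosSemidef.diagonal ?_
  rintro (i | i) <;> simp

/-! ### The central limit theorem for Wishart matrices -/

section CLT

variable {p : ℕ}

lemma memLp_inner_upperVec_vecMulVec (t : EuclideanSpace ℝ (Fin p ⊕ StrictUpper p)) :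
    MemLp (fun x : EuclideanSpace ℝ (Fin p) => ⟪upperVec (Matrix.vecMulVec x x), t⟫) 2
      (stdGaussian (EuclideanSpace ℝ (Fin p))) := by
  simp only [PiLp.inner_apply, RCLike.inner_apply, conj_trivial]
  exact memLp_finsetSum _ fun k _ => (memLp_upperVec_vecMulVec k).const_mul _

lemma integral_inner_upperVec_vecMulVec (t : EuclideanSpace ℝ (Fin p ⊕ StrictUpper p)) :
    ∫ x : EuclideanSpace ℝ (Fin p), ⟪upperVec (Matrix.vecMulVec x x), t⟫
      ∂stdGaussian (EuclideanSpace ℝ (Fin p)) =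
      ⟪upperVec (1 : Matrix (Fin p) (Fin p) ℝ), t⟫ := by
  simp only [PiLp.inner_apply, RCLike.inner_apply, conj_trivial]
  rw [integral_finsetSum]
  · simp_rw [integral_const_mul, integral_upperVec_vecMulVec]
  · exact fun k _ => ((memLp_upperVec_vecMulVec k).const_mul _).integrable (by norm_num)

lemma variance_inner_upperVec_vecMulVec (t : EuclideanSpace ℝ (Fin p ⊕ StrictUpper p)) :
    Var[fun x : EuclideanSpace ℝ (Fin p) => ⟪upperVec (Matrix.vecMulVec x x), t⟫;
      stdGaussian (EuclideanSpace ℝ (Fin p))] = 4 * (t ⬝ᵥ (limitCov p).mulVec t) := by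
  simp only [PiLp.inner_apply, RCLike.inner_apply, conj_trivial]
  rw [variance_fun_sum fun k => (memLp_upperVec_vecMulVec k).const_mul _]
  simp_rw [covariance_const_mul_left, covariance_const_mul_right, covariance_upperVec_vecMulVec,
    dotProduct, Matrix.mulVec, dotProduct, Finset.mul_sum]
  refine Finset.sum_congr rfl fun k _ => Finset.sum_congr rfl fun l _ => ?_
  ring

/-- The law of an infinite sequence of independent standard Gaussian vectors. -/
noncomputable abbrev gaussianSeqMeasure (p : ℕ) : Measure (ℕ → EuclideanSpace ℝ (Fin p)) :=
  Measure.infinitePi fun _ => stdGaussian (EuclideanSpace ℝ (Fin p))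

/-- The scatter matrix of the first `m` terms of a sequence of vectors. -/
noncomputable def scatterMatrix (m : ℕ) (ω : ℕ → EuclideanSpace ℝ (Fin p)) :
    Matrix (Fin p) (Fin p) ℝ :=
  ∑ k ∈ Finset.range m, Matrix.vecMulVec (ω k) (ω k)

/-- The centered and rescaled scatter matrix, as a vector. -/
noncomputable def scatterDeviation (m : ℕ) (ω : ℕ → EuclideanSpace ℝ (Fin p)) :
    EuclideanSpace ℝ (Fin p ⊕ StrictUpper p) :=
  upperVec ((√(m : ℝ))⁻¹ • scatterMatrix m ω - √(m : ℝ) • 1)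

lemma continuous_vecMulVec_self :
    Continuous fun x : EuclideanSpace ℝ (Fin p) => Matrix.vecMulVec x x := by
  refine continuous_matrix fun i j => ?_
  simp only [Matrix.vecMulVec_apply]
  fun_prop

lemma measurable_scatterMatrix (m : ℕ) :
    Measurable (scatterMatrix m : (ℕ → EuclideanSpace ℝ (Fin p)) → _) := by
  refine Continuous.measurable ?_
  exact continuous_finsetSum _ fun k _ => continuous_vecMulVec_self.comp (continuous_apply k)

lemma measurable_scatterDeviation (m : ℕ) :
    Measurable (scatterDeviation m : (ℕ → EuclideanSpace ℝ (Fin p)) → _) := by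
  have h : Continuous fun A : Matrix (Fin p) (Fin p) ℝ =>
      upperVec ((√(m : ℝ))⁻¹ • A - √(m : ℝ) • 1) := continuous_upperVec.comp (by fun_prop)
  exact h.measurable.comp (measurable_scatterMatrix m)

lemma scatterMatrix_nonneg (m : ℕ) (ω : ℕ → EuclideanSpace ℝ (Fin p)) :
    0 ≤ scatterMatrix m ω := by
  refine Finset.sum_nonneg fun k _ => Matrix.PosSemidef.nonneg ?_
  simpa using Matrix.posSemidef_vecMulVec_self_star (WithLp.ofLp (ω k))

/-- All Wishart laws are realized on one space as partial sums of a single iid sequence, as the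
central limit theorem requires. -/
lemma hasLaw_scatterMatrix (m : ℕ) :
    HasLaw (scatterMatrix m) (wishartMeasure p m 1) (gaussianSeqMeasure p) where
  aemeasurable := (measurable_scatterMatrix m).aemeasurable
  map_eq := by
    have h1 : (gaussianSeqMeasure p).map (fun ω (i : Fin m) => ω i) =
        Measure.pi fun _ : Fin m => stdGaussian (EuclideanSpace ℝ (Fin p)) := by
      have h := ((iIndepFun_infinitePi (P := fun _ : ℕ => stdGaussian (EuclideanSpace ℝ (Fin p)))
        (X := fun _ x => x) (fun _ => measurable_id)).precomp
          (Fin.val_injective (n := m))).map_fun_eq_pi_map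
          (fun i => (measurable_pi_apply _).aemeasurable)
      refine h.trans ?_
      congr with i : 1
      exact Measure.infinitePi_map_eval _ _
    have hc : Continuous fun X : Fin m → EuclideanSpace ℝ (Fin p) =>
        ∑ i, Matrix.vecMulVec (X i) (X i) :=
      continuous_finsetSum _ fun k _ => continuous_vecMulVec_self.comp (continuous_apply k)
    rw [wishartMeasure, multivariateGaussian_zero_one, ← h1,
      Measure.map_map hc.measurable (by fun_prop)]
    congr with ω : 1
    simp [scatterMatrix, Finset.sum_range]

lemma inner_scatterDeviation (m : ℕ) (ω : ℕ → EuclideanSpace ℝ (Fin p))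
    (t : EuclideanSpace ℝ (Fin p ⊕ StrictUpper p)) :
    ⟪scatterDeviation m ω, t⟫ = (√(m : ℝ))⁻¹ *
      (∑ k ∈ Finset.range m, ⟪upperVec (Matrix.vecMulVec (ω k) (ω k)), t⟫ -
        m * ⟪upperVec (1 : Matrix (Fin p) (Fin p) ℝ), t⟫) := by
  -- Also valid at `m = 0`, where both sides are 0.
  have h : √(m : ℝ) = (√(m : ℝ))⁻¹ * m := by
    rw [inv_mul_eq_div, Real.div_sqrt]
  rw [scatterDeviation, upperVec_sub, upperVec_smul, upperVec_smul, inner_sub_left,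
    real_inner_smul_left, real_inner_smul_left, scatterMatrix, upperVec_sum, sum_inner, mul_sub,
    ← mul_assoc, ← h]

lemma memLp_inner_upperVec_vecMulVec_eval (t : EuclideanSpace ℝ (Fin p ⊕ StrictUpper p)) (k : ℕ) :
    MemLp (fun ω => ⟪upperVec (Matrix.vecMulVec (ω k) (ω k)), t⟫) 2 (gaussianSeqMeasure p) :=
  (memLp_inner_upperVec_vecMulVec t).comp_measurePreserving
    (measurePreserving_eval_infinitePi (fun _ => stdGaussian (EuclideanSpace ℝ (Fin p))) k)

lemma measurable_inner_upperVec_vecMulVec (t : EuclideanSpace ℝ (Fin p ⊕ StrictUpper p)) :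
    Measurable fun x : EuclideanSpace ℝ (Fin p) => ⟪upperVec (Matrix.vecMulVec x x), t⟫ :=
  ((continuous_upperVec.comp continuous_vecMulVec_self).inner continuous_const).measurable

lemma iIndepFun_inner_upperVec_vecMulVec (t : EuclideanSpace ℝ (Fin p ⊕ StrictUpper p)) :
    iIndepFun (fun (k : ℕ) ω => ⟪upperVec (Matrix.vecMulVec (ω k) (ω k)), t⟫)
      (gaussianSeqMeasure p) :=
  iIndepFun_infinitePi (X := fun _ (x : EuclideanSpace ℝ (Fin p)) =>
    ⟪upperVec (Matrix.vecMulVec x x), t⟫) fun _ => measurable_inner_upperVec_vecMulVec t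

lemma integral_comp_eval_gaussianSeqMeasure {f : EuclideanSpace ℝ (Fin p) → ℝ}
    (hf : Measurable f) (k : ℕ) :
    ∫ ω, f (ω k) ∂gaussianSeqMeasure p = ∫ x, f x ∂stdGaussian (EuclideanSpace ℝ (Fin p)) := by
  rw [← Measure.infinitePi_map_eval (fun _ : ℕ => stdGaussian (EuclideanSpace ℝ (Fin p))) k,
    integral_map (measurable_pi_apply k).aemeasurable hf.aestronglyMeasurable]

lemma variance_comp_eval_gaussianSeqMeasure {f : EuclideanSpace ℝ (Fin p) → ℝ}
    (hf : Measurable f) (k : ℕ) :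
    Var[fun ω => f (ω k); gaussianSeqMeasure p] =
      Var[f; stdGaussian (EuclideanSpace ℝ (Fin p))] := by
  rw [← Measure.infinitePi_map_eval (fun _ : ℕ => stdGaussian (EuclideanSpace ℝ (Fin p))) k,
    variance_map hf.aemeasurable (measurable_pi_apply k).aemeasurable]
  rfl

lemma identDistrib_comp_eval_gaussianSeqMeasure {f : EuclideanSpace ℝ (Fin p) → ℝ}
    (hf : Measurable f) (k l : ℕ) :
    IdentDistrib (fun ω => f (ω k)) (fun ω => f (ω l)) (gaussianSeqMeasure p)
      (gaussianSeqMeasure p) := by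
  have h : IdentDistrib (fun ω : ℕ → EuclideanSpace ℝ (Fin p) => ω k) (fun ω => ω l)
      (gaussianSeqMeasure p) (gaussianSeqMeasure p) :=
    ⟨(measurable_pi_apply _).aemeasurable, (measurable_pi_apply _).aemeasurable, by
      simp only [Measure.infinitePi_map_eval]⟩
  exact h.comp hf

/-- The scalar central limit theorem applies to each projection; evaluating at 1 suffices because
`t` is arbitrary. -/
lemma tendsto_charFun_inner_scatterDeviation (t : EuclideanSpace ℝ (Fin p ⊕ StrictUpper p)) :
    Tendsto (fun m : ℕ => charFun ((gaussianSeqMeasure p).map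
      fun ω => ⟪scatterDeviation m ω, t⟫) 1) atTop
      (𝓝 (Complex.exp (-(4 * (t ⬝ᵥ (limitCov p).mulVec t) : ℝ) / 2))) := by
  set v := 4 * (t ⬝ᵥ (limitCov p).mulVec t) with hv
  have hv0 : 0 ≤ v := by
    rw [hv, ← variance_inner_upperVec_vecMulVec]; exact variance_nonneg _ _
  have hm := measurable_inner_upperVec_vecMulVec t
  have hvar : Var[fun ω => ⟪upperVec (Matrix.vecMulVec (ω 0) (ω 0)), t⟫; gaussianSeqMeasure p]
      = v := by
    rw [variance_comp_eval_gaussianSeqMeasure hm, variance_inner_upperVec_vecMulVec]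
  have h := tendstoInDistribution_inv_sqrt_mul_sum_sub
    (X := fun (k : ℕ) ω => ⟪upperVec (Matrix.vecMulVec (ω k) (ω k)), t⟫)
    (P := gaussianSeqMeasure p) (Y := id) (P' := gaussianReal 0 v.toNNReal)
    (by rw [hvar]; exact HasLaw.id) (memLp_inner_upperVec_vecMulVec_eval t 0)
    (iIndepFun_inner_upperVec_vecMulVec t)
    (fun k => identDistrib_comp_eval_gaussianSeqMeasure hm k 0)
  have h' := ProbabilityMeasure.tendsto_iff_tendsto_charFun.1 h.tendsto 1
  simp only [ProbabilityMeasure.coe_mk, Measure.map_id, charFun_gaussianReal,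
    integral_comp_eval_gaussianSeqMeasure hm, integral_inner_upperVec_vecMulVec,
    ← inner_scatterDeviation] at h'
  convert h' using 3
  simp [Real.coe_toNNReal _ hv0, neg_div]

lemma charFun_map_eq_charFun_map_inner {Ω E : Type*} [MeasurableSpace Ω]
    [NormedAddCommGroup E] [InnerProductSpace ℝ E] [MeasurableSpace E] [BorelSpace E]
    [SecondCountableTopology E] {P : Measure Ω} {f : Ω → E} (hf : AEMeasurable f P) (t : E) :
    charFun (P.map f) t = charFun (P.map fun ω => ⟪f ω, t⟫) 1 := by
  rw [charFun_apply, charFun_apply_real, integral_map hf (by fun_prop),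
    integral_map (by fun_prop) (by fun_prop)]
  simp

theorem tendstoInDistribution_half_smul_scatterDeviation {Ω₁ : Type*} [MeasurableSpace Ω₁]
    {P₁ : Measure Ω₁} [IsProbabilityMeasure P₁]
    {Z : Ω₁ → EuclideanSpace ℝ (Fin p ⊕ StrictUpper p)}
    (hZ : HasLaw Z (multivariateGaussian 0 (limitCov p)) P₁) :
    TendstoInDistribution (fun (m : ℕ) ω => (1 / 2 : ℝ) • scatterDeviation m ω) atTop Z
      (fun _ => gaussianSeqMeasure p) P₁ where
  forall_aemeasurable m := ((measurable_scatterDeviation m).fun_const_smul (1 / 2 : ℝ)).aemeasurable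
  aemeasurable_limit := hZ.aemeasurable
  tendsto := by
    refine ProbabilityMeasure.tendsto_iff_tendsto_charFun.2 fun t => ?_
    -- The factor ½ moves onto `t`, where its square cancels the 4 in the variance.
    have h := tendsto_charFun_inner_scatterDeviation ((1 / 2 : ℝ) • t)
    simp only [ProbabilityMeasure.coe_mk]
    rw [hZ.map_eq, charFun_multivariateGaussian (posSemidef_limitCov p)]
    convert h using 2 with m
    · rw [charFun_map_eq_charFun_map_inner
        ((measurable_scatterDeviation m).fun_const_smul (1 / 2 : ℝ)).aemeasurable]
      simp only [real_inner_smul_left, real_inner_smul_right]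
    · congr 1
      simp [Matrix.mulVec_smul]
      ring

end CLT

/-! ### Asymptotic normality of the square root of a scatter matrix -/

section Remainder

variable {p : ℕ}

lemma memLp_inner_scatterDeviation (m : ℕ) (t : EuclideanSpace ℝ (Fin p ⊕ StrictUpper p)) :
    MemLp (fun ω => ⟪scatterDeviation m ω, t⟫) 2 (gaussianSeqMeasure p) := by
  simp_rw [inner_scatterDeviation]
  exact ((memLp_finsetSum _ fun k _ => memLp_inner_upperVec_vecMulVec_eval t k).sub
    (memLp_const _)).const_mul _

lemma integral_inner_scatterDeviation (m : ℕ) (t : EuclideanSpace ℝ (Fin p ⊕ StrictUpper p)) :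
    ∫ ω, ⟪scatterDeviation m ω, t⟫ ∂gaussianSeqMeasure p = 0 := by
  have hi : ∀ k : ℕ, Integrable (fun ω => ⟪upperVec (Matrix.vecMulVec (ω k) (ω k)), t⟫)
      (gaussianSeqMeasure p) :=
    fun k => (memLp_inner_upperVec_vecMulVec_eval t k).integrable (by norm_num)
  simp_rw [inner_scatterDeviation]
  rw [integral_const_mul, integral_sub (integrable_finsetSum _ fun k _ => hi k)
    (integrable_const _), integral_finsetSum _ fun k _ => hi k]
  simp [integral_comp_eval_gaussianSeqMeasure (measurable_inner_upperVec_vecMulVec t),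
    integral_inner_upperVec_vecMulVec]

/-- Variances of independent terms add, so the normalization makes the second moment independent of
`m`. -/
lemma integral_sq_inner_scatterDeviation {m : ℕ} (hm : 0 < m)
    (t : EuclideanSpace ℝ (Fin p ⊕ StrictUpper p)) :
    ∫ ω, ⟪scatterDeviation m ω, t⟫ ^ 2 ∂gaussianSeqMeasure p =
      4 * (t ⬝ᵥ (limitCov p).mulVec t) := by
  have hL := memLp_inner_upperVec_vecMulVec_eval t
  rw [← variance_of_integral_eq_zero (memLp_inner_scatterDeviation m t).aemeasurable
    (integral_inner_scatterDeviation m t)]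
  simp_rw [inner_scatterDeviation]
  rw [variance_const_mul, variance_sub_const
    (memLp_finsetSum _ fun k _ => hL k).aestronglyMeasurable]
  have h := IndepFun.variance_sum (s := Finset.range m) (fun k _ => hL k)
    (fun i _ j _ hij => (iIndepFun_inner_upperVec_vecMulVec t).indepFun hij)
  have h' : (∑ k ∈ Finset.range m, fun ω : ℕ → EuclideanSpace ℝ (Fin p) =>
      ⟪upperVec (Matrix.vecMulVec (ω k) (ω k)), t⟫) =
      fun ω => ∑ k ∈ Finset.range m, ⟪upperVec (Matrix.vecMulVec (ω k) (ω k)), t⟫ := by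
    ext ω; simp
  rw [h'] at h
  rw [h]
  simp only [variance_comp_eval_gaussianSeqMeasure (measurable_inner_upperVec_vecMulVec t),
    variance_inner_upperVec_vecMulVec, Finset.sum_const, Finset.card_range, nsmul_eq_mul]
  rw [inv_pow, Real.sq_sqrt (by positivity), inv_mul_cancel_left₀ (by positivity)]

lemma norm_scatterDeviation_sq (m : ℕ) (ω : ℕ → EuclideanSpace ℝ (Fin p)) :
    ‖scatterDeviation m ω‖ ^ 2 =
      ∑ k, ⟪scatterDeviation m ω, EuclideanSpace.single k (1 : ℝ)⟫ ^ 2 := by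
  rw [EuclideanSpace.real_norm_sq_eq]
  refine Finset.sum_congr rfl fun k _ => ?_
  rw [EuclideanSpace.inner_single_right]
  simp

lemma integrable_norm_scatterDeviation_sq (m : ℕ) :
    Integrable (fun ω => ‖scatterDeviation m ω‖ ^ 2) (gaussianSeqMeasure p) := by
  simp_rw [norm_scatterDeviation_sq]
  exact integrable_finsetSum _ fun k _ => (memLp_inner_scatterDeviation m _).integrable_sq

lemma integral_norm_scatterDeviation_sq {m : ℕ} (hm : 0 < m) :
    ∫ ω, ‖scatterDeviation m ω‖ ^ 2 ∂gaussianSeqMeasure p = 4 * (limitCov p).trace := by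
  simp_rw [norm_scatterDeviation_sq]
  rw [integral_finsetSum _ fun k _ => (memLp_inner_scatterDeviation m _).integrable_sq]
  simp_rw [integral_sq_inner_scatterDeviation hm]
  rw [Matrix.trace, Finset.mul_sum]
  refine Finset.sum_congr rfl fun k _ => ?_
  simp

lemma isSymm_scatterMatrix (m : ℕ) (ω : ℕ → EuclideanSpace ℝ (Fin p)) :
    (scatterMatrix m ω).IsSymm := by
  have h := (Matrix.nonneg_iff_posSemidef.1 (scatterMatrix_nonneg m ω)).isHermitian
  rwa [Matrix.IsHermitian, Matrix.conjTranspose_eq_transpose_of_trivial] at h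

lemma norm_upperVec_cfcSqrt_sub_le {m : ℕ} (hm : 0 < m)
    (ω : ℕ → EuclideanSpace ℝ (Fin p)) :
    ‖upperVec (CFC.sqrt (scatterMatrix m ω) - √(m : ℝ) • 1) -
      (1 / 2 : ℝ) • scatterDeviation m ω‖ ≤
      Fintype.card (Fin p ⊕ StrictUpper p) * p ^ 2 * (2 * √(m : ℝ))⁻¹ *
        ‖scatterDeviation m ω‖ ^ 2 := by
  have hc : 0 < √(m : ℝ) := by positivity
  have hS := scatterMatrix_nonneg m ω
  set b : ℝ := p ^ 2 * (2 * √(m : ℝ))⁻¹ * ‖scatterDeviation m ω‖ ^ 2 with hb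
  have hb0 : 0 ≤ b := by positivity
  have hsymm : ((√(m : ℝ))⁻¹ • scatterMatrix m ω - √(m : ℝ) • 1).IsSymm :=
    ((isSymm_scatterMatrix m ω).smul _).sub (Matrix.isSymm_one.smul _)
  have hentry : ∀ i j, |((CFC.sqrt (scatterMatrix m ω) - √(m : ℝ) • 1) -
      (1 / 2 : ℝ) • ((√(m : ℝ))⁻¹ • scatterMatrix m ω - √(m : ℝ) • 1)) i j| ≤ b := by
    intro i j
    refine (Matrix.abs_cfcSqrt_sub_sub_half_smul_le hS hc i j).trans ?_
    calc _ ≤ (2 * √(m : ℝ))⁻¹ * (p ^ 2 * ‖scatterDeviation m ω‖ ^ 2) := by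
          gcongr
          exact sum_sq_le_norm_upperVec_sq hsymm
      _ = b := by rw [hb]; ring
  rw [scatterDeviation, ← upperVec_smul, ← upperVec_sub, ← scatterDeviation, mul_assoc, mul_assoc,
    ← mul_assoc _ _ (‖scatterDeviation m ω‖ ^ 2), ← hb]
  set R := upperVec ((CFC.sqrt (scatterMatrix m ω) - √(m : ℝ) • 1) -
      (1 / 2 : ℝ) • ((√(m : ℝ))⁻¹ • scatterMatrix m ω - √(m : ℝ) • 1)) with hR
  have hRk : ∀ k, R k ^ 2 ≤ b ^ 2 := by
    intro k
    rw [← sq_abs]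
    refine pow_le_pow_left₀ (abs_nonneg _) ?_ 2
    rcases k with i | i
    · exact hentry i i
    · exact hentry i.1.1 i.1.2
  refine abs_le_of_sq_le_sq' ?_ (by positivity) |>.2
  rw [EuclideanSpace.real_norm_sq_eq, mul_pow]
  calc ∑ k, R k ^ 2 ≤ ∑ _k : Fin p ⊕ StrictUpper p, b ^ 2 := Finset.sum_le_sum fun k _ => hRk k
    _ = Fintype.card (Fin p ⊕ StrictUpper p) * b ^ 2 := by simp
    -- Squaring the cardinality is wasteful but makes the bound a perfect square.
    _ ≤ (Fintype.card (Fin p ⊕ StrictUpper p) : ℝ) ^ 2 * b ^ 2 := by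
        gcongr
        exact_mod_cast Nat.le_self_pow (by norm_num) _

lemma measurable_upperVec_cfcSqrt_sub (c : ℝ) :
    Measurable fun A : Matrix (Fin p) (Fin p) ℝ => upperVec (CFC.sqrt A - c • 1) := by
  have h : Continuous fun A : Matrix (Fin p) (Fin p) ℝ => upperVec (A - c • 1) :=
    continuous_upperVec.comp (by fun_prop)
  exact h.measurable.comp Matrix.measurable_cfcSqrt

/-- The pointwise bound is a multiple of `‖scatterDeviation m ω‖² / √m`, whose numerator has
constant expectation; so the difference vanishes in `L¹`. -/
lemma tendstoInMeasure_upperVec_cfcSqrt_sub :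
    TendstoInMeasure (gaussianSeqMeasure p)
      ((fun (m : ℕ) ω => upperVec (CFC.sqrt (scatterMatrix m ω) - √(m : ℝ) • 1)) -
        fun (m : ℕ) ω => (1 / 2 : ℝ) • scatterDeviation m ω) atTop 0 := by
  have hmeas (m : ℕ) : Measurable fun ω : ℕ → EuclideanSpace ℝ (Fin p) =>
      upperVec (CFC.sqrt (scatterMatrix m ω) - √(m : ℝ) • 1) -
        (1 / 2 : ℝ) • scatterDeviation m ω :=
    ((measurable_upperVec_cfcSqrt_sub _).comp (measurable_scatterMatrix m)).sub
      ((measurable_scatterDeviation m).fun_const_smul (1 / 2 : ℝ))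
  refine tendstoInMeasure_of_tendsto_eLpNorm (p := 1) one_ne_zero
    (fun m => (hmeas m).aestronglyMeasurable) aestronglyMeasurable_zero ?_
  set K : ℝ := Fintype.card (Fin p ⊕ StrictUpper p) * p ^ 2
  have hlim : Tendsto (fun m : ℕ => ENNReal.ofReal
      (K * (2 * √(m : ℝ))⁻¹ * (4 * (limitCov p).trace))) atTop (𝓝 0) := by
    have h1 : Tendsto (fun m : ℕ => (2 * √(m : ℝ))⁻¹) atTop (𝓝 0) :=
      tendsto_inv_atTop_zero.comp ((Real.tendsto_sqrt_atTop.comp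
        tendsto_natCast_atTop_atTop).const_mul_atTop (by norm_num))
    have h2 := ENNReal.tendsto_ofReal ((h1.const_mul K).mul_const (4 * (limitCov p).trace))
    simpa using h2
  refine tendsto_of_tendsto_of_tendsto_of_le_of_le' tendsto_const_nhds hlim
    (Eventually.of_forall fun _ => zero_le) ?_
  filter_upwards [eventually_gt_atTop 0] with m hm
  rw [eLpNorm_one_eq_lintegral_enorm, ← integral_norm_scatterDeviation_sq hm,
    ← integral_const_mul, ofReal_integral_eq_lintegral_ofReal
      ((integrable_norm_scatterDeviation_sq m).const_mul _)
      (ae_of_all _ fun ω => by positivity)]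
  refine lintegral_mono fun ω => ?_
  rw [← ofReal_norm]
  refine ENNReal.ofReal_le_ofReal ?_
  simpa only [Pi.sub_apply, Pi.zero_apply, sub_zero] using norm_upperVec_cfcSqrt_sub_le hm ω

/-- Slutsky's theorem: the linearization converges in law and the error tends to 0 in probability.
-/
theorem tendstoInDistribution_upperVec_cfcSqrt_scatterMatrix {Ω₁ : Type*} [MeasurableSpace Ω₁]
    {P₁ : Measure Ω₁} [IsProbabilityMeasure P₁]
    {Z : Ω₁ → EuclideanSpace ℝ (Fin p ⊕ StrictUpper p)}
    (hZ : HasLaw Z (multivariateGaussian 0 (limitCov p)) P₁) :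
    TendstoInDistribution
      (fun (m : ℕ) ω => upperVec (CFC.sqrt (scatterMatrix m ω) - √(m : ℝ) • 1)) atTop Z
      (fun _ => gaussianSeqMeasure p) P₁ :=
  tendstoInDistribution_of_tendstoInMeasure_sub _ _
    (tendstoInDistribution_half_smul_scatterDeviation hZ) tendstoInMeasure_upperVec_cfcSqrt_sub
    fun m => ((measurable_upperVec_cfcSqrt_sub _).comp (measurable_scatterMatrix m)).aemeasurable

end Remainder

/-! ### Transfer to arbitrary Wishart matrices -/

/-- Convergence in distribution only depends on the laws, and passes to a tail of the index set. -/
lemma MeasureTheory.TendstoInDistribution.of_identDistrib_Ici {E : Type*} [TopologicalSpace E]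
    [MeasurableSpace E] [OpensMeasurableSpace E] {p : ℕ}
    {Ω' Ω₁ : Type*} [MeasurableSpace Ω'] [MeasurableSpace Ω₁]
    {Q : Measure Ω'} [IsProbabilityMeasure Q] {P₁ : Measure Ω₁} [IsProbabilityMeasure P₁]
    {Ω : Set.Ici p → Type*} [∀ m, MeasurableSpace (Ω m)]
    {P : ∀ m, Measure (Ω m)} [∀ m, IsProbabilityMeasure (P m)]
    {X : ℕ → Ω' → E} {Y : ∀ m, Ω m → E} {Z : Ω₁ → E}
    (h : TendstoInDistribution X atTop Z (fun _ => Q) P₁)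
    (hXY : ∀ m : Set.Ici p, IdentDistrib (Y m) (X m) (P m) Q) :
    TendstoInDistribution Y atTop Z P P₁ where
  forall_aemeasurable m := (hXY m).aemeasurable_fst
  aemeasurable_limit := h.aemeasurable_limit
  tendsto := by
    have h1 := (tendsto_comp_val_Ici_atTop (a := p)).2 h.tendsto
    refine h1.congr fun m => ?_
    exact Subtype.ext (hXY m).map_eq.symm

/-- Convergence in distribution implies convergence of the joint distribution functions, if the
coordinates of the limit have no atoms. -/
lemma MeasureTheory.TendstoInDistribution.tendsto_distFun {ι κ Ω₁ : Type*} [Fintype κ] {l : Filter ι}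
    {Ω : ι → Type*} [∀ m, MeasurableSpace (Ω m)] [MeasurableSpace Ω₁]
    {P : ∀ m, Measure (Ω m)} [∀ m, IsProbabilityMeasure (P m)]
    {P₁ : Measure Ω₁} [IsProbabilityMeasure P₁]
    {X : ∀ m, Ω m → EuclideanSpace ℝ κ} {Z : Ω₁ → EuclideanSpace ℝ κ}
    (h : TendstoInDistribution X l Z P P₁) (x : EuclideanSpace ℝ κ)
    (hx : ∀ k, P₁ {ω | Z ω k = x k} = 0) :
    Tendsto (fun m => distFun (P m) (X m) x) l (𝓝 (distFun P₁ Z x)) := by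
  set s : Set (EuclideanSpace ℝ κ) := {y | ∀ k, y k ≤ x k} with hs
  have hclosed : IsClosed s := by
    rw [hs, Set.ofPred_forall]
    exact isClosed_iInter fun k => isClosed_le (by fun_prop) (by fun_prop)
  have hopen : IsOpen {y : EuclideanSpace ℝ κ | ∀ k, y k < x k} := by
    rw [Set.ofPred_forall]
    exact isOpen_iInter_of_finite fun k => isOpen_lt (by fun_prop) (by fun_prop)
  -- A point of `s` with all inequalities strict is interior, so the boundary lies in coordinate
  -- hyperplanes; once these are null the portmanteau theorem applies.
  have hfr : frontier s ⊆ ⋃ k, {y | y k = x k} := by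
    intro y hy
    rw [hclosed.frontier_eq] at hy
    by_contra hne
    simp only [Set.mem_iUnion, not_exists] at hne
    refine hy.2 (interior_maximal (fun z hz k => (hz k).le) hopen ?_)
    exact fun k => lt_of_le_of_ne (hy.1 k) (hne k)
  have hnull : P₁.map Z (frontier s) = 0 := by
    refine measure_mono_null hfr (measure_iUnion_null fun k => ?_)
    rw [Measure.map_apply_of_aemeasurable h.aemeasurable_limit
      (isClosed_eq (by fun_prop) (by fun_prop)).measurableSet]
    exact hx k
  have := Measure.isProbabilityMeasure_map h.aemeasurable_limit
  have h1 := ProbabilityMeasure.tendsto_measure_of_null_frontier_of_tendsto' h.tendsto hnull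
  have h2 := (ENNReal.tendsto_toReal (measure_ne_top (P₁.map Z) s)).comp h1
  have e1 : ∀ m, ((P m).map (X m) s).toReal = distFun (P m) (X m) x := fun m => by
    rw [Measure.map_apply_of_aemeasurable (h.forall_aemeasurable m) hclosed.measurableSet]; rfl
  have e2 : (P₁.map Z s).toReal = distFun P₁ Z x := by
    rw [Measure.map_apply_of_aemeasurable h.aemeasurable_limit hclosed.measurableSet]; rfl
  simpa only [Function.comp_def, ProbabilityMeasure.coe_mk, e1, e2] using h2

/-- Each marginal is Gaussian with positive variance ½ or ¼, hence has no atoms. -/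
lemma measure_eval_eq_zero_of_hasLaw_limitCov {p : ℕ} {Ω₁ : Type*} [MeasurableSpace Ω₁]
    {P₁ : Measure Ω₁} {Z : Ω₁ → EuclideanSpace ℝ (Fin p ⊕ StrictUpper p)}
    (hZ : HasLaw Z (multivariateGaussian 0 (limitCov p)) P₁) (k : Fin p ⊕ StrictUpper p) (a : ℝ) :
    P₁ {ω | Z ω k = a} = 0 := by
  have hmp := measurePreserving_eval_multivariateGaussian (μ := 0) (posSemidef_limitCov p) (i := k)
  have hv : (limitCov p k k).toNNReal ≠ 0 := by
    rcases k with i | i <;> simp [limitCov]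
  have := nullSingletonClass_gaussianReal (μ := (0 : EuclideanSpace ℝ (Fin p ⊕ StrictUpper p)) k) hv
  have hms : MeasurableSet {y : EuclideanSpace ℝ (Fin p ⊕ StrictUpper p) | y k = a} :=
    (isClosed_eq (by fun_prop) (by fun_prop)).measurableSet
  have h1 : multivariateGaussian 0 (limitCov p)
      {y : EuclideanSpace ℝ (Fin p ⊕ StrictUpper p) | y k = a} = 0 := by
    have := hmp.measure_preimage (measurableSet_singleton a).nullMeasurableSet
    rw [measure_singleton] at this
    exact this
  rw [← hZ.map_eq, Measure.map_apply_of_aemeasurable hZ.aemeasurable hms] at h1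
  exact h1

lemma IsGaussianWigner.aemeasurable_upperVec {p : ℕ} {Ω : Type*} [MeasurableSpace Ω]
    {P : Measure Ω} {G : Ω → Matrix (Fin p) (Fin p) ℝ} (hG : IsGaussianWigner G P) :
    AEMeasurable (fun ω => upperVec (G ω)) P := by
  refine (PiLp.continuous_toLp 2 _).measurable.comp_aemeasurable (aemeasurable_pi_lambda _ ?_)
  rintro (i | ij)
  · exact (hG.diag i).aemeasurable
  · exact (hG.upper _ _ ij.2).aemeasurable

/-- Half of a Gaussian Wigner matrix, as a vector, is Gaussian with covariance `limitCov`. -/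
lemma IsGaussianWigner.hasLaw_upperVec_half {p : ℕ} {Ω : Type*} [MeasurableSpace Ω]
    {P : Measure Ω} [IsProbabilityMeasure P] {G : Ω → Matrix (Fin p) (Fin p) ℝ}
    (hG : IsGaussianWigner G P) :
    HasLaw (fun ω => upperVec ((1 / 2 : ℝ) • G ω)) (multivariateGaussian 0 (limitCov p)) P where
  aemeasurable := by
    simp_rw [upperVec_smul]
    exact hG.aemeasurable_upperVec.fun_const_smul _
  map_eq := by
    have hlaw : ∀ k, P.map (fun ω => upperVec (G ω) k) =
        gaussianReal 0 (4 * limitCov p k k).toNNReal := by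
      rintro (i | ij)
      · rw [show (4 * limitCov p (Sum.inl i) (Sum.inl i)).toNNReal = 2 by
          ext; simp [limitCov]; norm_num]
        exact (hG.diag i).map_eq
      · rw [show (4 * limitCov p (Sum.inr ij) (Sum.inr ij)).toNNReal = 1 by
          ext; simp [limitCov]]
        exact (hG.upper _ _ ij.2).map_eq
    have hmeas : ∀ k, AEMeasurable (fun ω => upperVec (G ω) k) P := fun k =>
      (by fun_prop : Measurable fun v : EuclideanSpace ℝ (Fin p ⊕ StrictUpper p) =>
        v k).comp_aemeasurable hG.aemeasurable_upperVec
    have hpi := hG.indep.map_fun_eq_pi_map hmeas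
    simp_rw [hlaw] at hpi
    have hU : P.map (fun ω => upperVec (G ω)) =
        (Measure.pi fun k => gaussianReal 0 (4 * limitCov p k k).toNNReal).map
          (WithLp.toLp 2) := by
      rw [← hpi, AEMeasurable.map_map_of_aemeasurable (by fun_prop)
        (aemeasurable_pi_lambda _ hmeas)]
      rfl
    apply Measure.ext_of_charFun (E := EuclideanSpace ℝ (Fin p ⊕ StrictUpper p))
    ext t
    have hs : P.map (fun ω => upperVec ((1 / 2 : ℝ) • G ω)) =
        (P.map (fun ω => upperVec (G ω))).map (fun v => (1 / 2 : ℝ) • v) := by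
      rw [AEMeasurable.map_map_of_aemeasurable (by fun_prop) hG.aemeasurable_upperVec]
      simp_rw [upperVec_smul]; rfl
    have hnn : ∀ k, 0 ≤ limitCov p k k := by rintro (i | i) <;> simp [limitCov]
    -- By independence the characteristic function is a product of Gaussian ones at `t/2`; the
    -- exponents sum to the quadratic form of the diagonal `limitCov`.
    rw [hs, charFun_map_smul, hU, charFun_pi,
      charFun_multivariateGaussian (posSemidef_limitCov p)]
    simp_rw [charFun_gaussianReal, ← Complex.exp_sum]
    congr 1
    rw [limitCov_eq_diagonal] at hnn ⊢
    simp only [Matrix.diagonal_apply_eq] at hnn ⊢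
    simp only [dotProduct, Real.coe_toNNReal _ (mul_nonneg zero_le_four (hnn _))]
    simp only [inner_zero_right, Complex.ofReal_zero, zero_mul, mul_zero, zero_sub,
      Complex.ofReal_sum, Finset.sum_neg_distrib, Finset.sum_div]
    congr 1
    refine Finset.sum_congr rfl fun k _ => ?_
    simp only [Matrix.mulVec_diagonal]
    simp
    ring

theorem tendstoInDistribution_upperVec_cfcSqrt_wishart {p : ℕ}
    {Ω : Set.Ici p → Type*} [∀ m, MeasurableSpace (Ω m)]
    {P : ∀ m, Measure (Ω m)} [∀ m, IsProbabilityMeasure (P m)]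
    {W : ∀ m, Ω m → Matrix (Fin p) (Fin p) ℝ}
    (hW : ∀ m, HasLaw (W m) (wishartMeasure p (m : ℕ) 1) (P m))
    {Ω₁ : Type*} [MeasurableSpace Ω₁] {P₁ : Measure Ω₁} [IsProbabilityMeasure P₁]
    {Z : Ω₁ → EuclideanSpace ℝ (Fin p ⊕ StrictUpper p)}
    (hZ : HasLaw Z (multivariateGaussian 0 (limitCov p)) P₁) :
    TendstoInDistribution
      (fun m ω => upperVec (CFC.sqrt (W m ω) - √((m : ℕ) : ℝ) • 1)) atTop Z P P₁ :=
  (tendstoInDistribution_upperVec_cfcSqrt_scatterMatrix hZ).of_identDistrib_Ici fun m =>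
    ((hW m).identDistrib (hasLaw_scatterMatrix (m : ℕ))).comp
      (measurable_upperVec_cfcSqrt_sub _)

theorem mainTheorem2 (p : ℕ) (hp : 0 < p)
    -- for every `m ≥ p`, a random matrix `W m` with law `W_p(m, I_p)`
    {Ω : Set.Ici p → Type*} [∀ m, MeasurableSpace (Ω m)]
    (P : ∀ m, Measure (Ω m)) [∀ m, IsProbabilityMeasure (P m)]
    (W : ∀ m, Ω m → Matrix (Fin p) (Fin p) ℝ)
    (hW : ∀ m, HasLaw (W m) (wishartMeasure p (m : ℕ) 1) (P m))
    -- a random vector `Z` with law `N(0, diag(½ I, ¼ I))`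
    {Ω₁ : Type*} [MeasurableSpace Ω₁] (P₁ : Measure Ω₁) [IsProbabilityMeasure P₁]
    (Z : Ω₁ → EuclideanSpace ℝ (Fin p ⊕ StrictUpper p))
    (hZ : HasLaw Z (multivariateGaussian 0 (limitCov p)) P₁)
    -- a Gaussian Wigner matrix `G`
    {Ω₂ : Type*} [MeasurableSpace Ω₂] (P₂ : Measure Ω₂) [IsProbabilityMeasure P₂]
    (G : Ω₂ → Matrix (Fin p) (Fin p) ℝ) (hG : IsGaussianWigner G P₂) :
    -- weak convergence of the laws of the vectors
    TendstoInDistribution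
      (fun m ω => upperVec (CFC.sqrt (W m ω) - √((m : ℕ) : ℝ) • 1)) atTop Z P P₁ ∧
    -- convergence of the distribution functions of the vectors at all continuity points
    (∀ x, ContinuousAt (distFun P₁ Z) x →
      Tendsto
        (fun m => distFun (P m)
          (fun ω => upperVec (CFC.sqrt (W m ω) - √((m : ℕ) : ℝ) • 1)) x)
        atTop (𝓝 (distFun P₁ Z x))) ∧
    -- weak convergence of the laws of the matrices
    TendstoInDistribution
      (fun m ω => CFC.sqrt (W m ω) - √((m : ℕ) : ℝ) • (1 : Matrix (Fin p) (Fin p) ℝ)) atTop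
      (fun ω => (1 / 2 : ℝ) • G ω) P P₂ := by

  have hvec := tendstoInDistribution_upperVec_cfcSqrt_wishart hW hZ
  refine ⟨hvec, fun x _ => hvec.tendsto_distFun x fun k =>
    measure_eval_eq_zero_of_hasLaw_limitCov hZ k (x k), ?_⟩
  -- Half of `G` serves as the limit vector; the continuous mapping theorem then rebuilds the
  -- matrices, which are symmetric surely on the left and almost surely in the limit.
  have hmat := (tendstoInDistribution_upperVec_cfcSqrt_wishart hW
    hG.hasLaw_upperVec_half).continuous_comp continuous_symmOfUpper
  refine hmat.congr (fun m => ae_of_all _ fun ω => ?_) ?_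
  · exact symmOfUpper_upperVec ((Matrix.isSymm_cfcSqrt _).sub (Matrix.isSymm_one.smul _))
  · filter_upwards [hG.symm] with ω hω
    exact symmOfUpper_upperVec (hω.smul _)
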